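/- **Theorem (Locally Gorenstein Rings Having the Cayley-Bacharach Property).** Let $K$ be a field, $P=K[x_1,\dots,x_n]$, let $I\subset P$ be a $0$-dimensional ideal (i.e. $P/I$ has Krull dimension $0$), and let $R=P/I$. *Notation.* For $i\in\mathbb Z$ let $F_iP=\{f\in P\mid \deg f\le i\}\cup\{0\}$ and let $F_iR$ be the image of $F_iP$ in $R$. Let $\operatorname{ri}(R)=\min\{i\in\mathbb Z\mid \dim_K F_jR=\dim_K R \text{ for all } j\ge i\}$, and for $f\in R\setminus\{0\}$ let $\operatorname{ord}(f)=\min\{i\mid f\in F_iR\setminus F_{i-1}R\}$. The canonical module is $\omega_R=\operatorname{Hom}_K(R,K)$ with $(f\varphi)(g)=\varphi(fg)$; put $G_i\omega_R=\{\varphi\in\omega_R\mid\varphi(F_{-i-1}R)=0\}$, and for $\varphi\ne0$ let $\operatorname{ord}(\varphi)=\min\{i\in\mathbb Z\mid\varphi\in G_i\omega_R\}$. For a field extension $L\supseteq K$ let $R_L=R\otimes_KL$, an affine $L$-algebra with the generators $\bar x_j\otimes1$, i.e. $R_L\cong L[x_1,\dots,x_n]/I\,L[x_1,\dots,x_n]$;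 the above notions are used for $R_L$ over $L$ in the same way. Let $I=\mathfrak Q_1\cap\dots\cap\mathfrak Q_s$ be the primary decomposition of $I$ and $\mathfrak M_i=\operatorname{Rad}(\mathfrak Q_i)$. A *minimal $\mathfrak Q_i$-divisor* of $I$ is an ideal $J=\mathfrak Q_i'\cap\bigcap_{j\ne i}\mathfrak Q_j$, where $\mathfrak Q_i'\subseteq P$ is an ideal with $\mathfrak Q_i\subsetneq\mathfrak Q_i'$ (and $\mathfrak Q_i'=P$ is allowed), such that $\dim_K(J/I)=\dim_K(P/\mathfrak M_i)$. The *separator degree* of the maximal ideal $\mathfrak m_i=\mathfrak M_i/I$ is the minimum, over all minimal $\mathfrak Q_i$-divisors $J$ of $I$, of $\max\{\operatorname{ord}(f)\mid f\in (J/I)\setminus\{0\}\}$. The ring $R$ has the *Cayley-Bacharach property* if the separator degree of $\mathfrak m_i$ equals $\operatorname{ri}(R)$ for every $i=1,\dots,s$. The ring $R$ is *locally Gorenstein* if, for each primary component $\mathfrak q$ of the zero ideal of $R$, the local ring $A=R/\mathfrak q$ with maximal ideal $\mathfrak m_A$ satisfies $\dim_{A/\mathfrak m_A}\operatorname{Ann}_A(\mathfrak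 m_A)=1$. *Claim.* The following conditions are equivalent. (a) There exist a field extension $K\subseteq L$ and an element $\varphi\in\omega_{R_L}$ such that $\operatorname{ord}(\varphi)=-\operatorname{ri}(R_L)$ and $\operatorname{Ann}_{R_L}(\varphi)=\{0\}$. (b) The ring $R$ is locally Gorenstein and has the Cayley-Bacharach property. If $K$ is infinite and these conditions hold, then $L=K$ satisfies condition (a). -/

import Mathlib

open scoped TensorProduct

universe u v

noncomputable section

namespace CayleyBacharach

section Filtration

variable (k : Type*) [Field k] {n : ℕ}

/-- The degree filtration of the polynomial ring `P = k[x₁, …, xₙ]`: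
`F_i P = {f ∈ P | deg f ≤ i} ∪ {0}` for `i ∈ ℤ`. -/
def polyFiltration (n : ℕ) (i : ℤ) : Submodule k (MvPolynomial (Fin n) k) where
  carrier := {f | f = 0 ∨ (f.totalDegree : ℤ) ≤ i}
  zero_mem' := Or.inl rfl
  add_mem' := by
    rintro f g (rfl | hf) (rfl | hg)
    · simp
    · right; simpa using hg
    · right; simpa using hf
    · right
      have h := MvPolynomial.totalDegree_add f g
      rcases le_total f.totalDegree g.totalDegree with h' | h'
      · rw [max_eq_right h'] at h; omega
      · rw [max_eq_left h'] at h; omega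
  smul_mem' := by
    rintro c f (rfl | hf)
    · simp
    · right
      have h := MvPolynomial.totalDegree_smul_le c f
      omega

variable {A : Type*} [CommRing A] [Algebra k A] (x : Fin n → A)

/-- The degree filtration of a `k`-algebra `A` generated by `x₁, …, xₙ`, i.e. of `A` presented
as a quotient of `P` by `X_j ↦ x_j`: `F_i A` is the image of `F_i P`. -/
def degreeFiltration (i : ℤ) : Submodule k A :=
  (polyFiltration k n i).map (MvPolynomial.aeval x : MvPolynomial (Fin n) k →ₐ[k] A).toLinearMap

/-- The affine Hilbert function `i ↦ dim_k (F_i A)`. -/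
def hilbertFunction (i : ℤ) : ℕ := Module.finrank k (degreeFiltration k x i)

/-- The regularity index: the least `i` with `HF(j) = dim_k A` for all `j ≥ i`. -/
def regularityIndex : ℤ :=
  sInf {i : ℤ | ∀ j : ℤ, i ≤ j → hilbertFunction k x j = Module.finrank k A}

/-- The order of a (non-zero) element of `A` with respect to the degree filtration. -/
def order (f : A) : ℤ :=
  sInf {i : ℤ | f ∈ degreeFiltration k x i ∧ f ∉ degreeFiltration k x (i - 1)}

/-- For a non-zero ideal `J` of `A`, the largest order of a non-zero element of `J`. -/
def idealRegularityIndex (J : Ideal A) : ℤ :=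
  sSup {r : ℤ | ∃ f ∈ J, f ≠ 0 ∧ order k x f = r}

end Filtration

section Canonical

/-- The canonical module `ω_A = Hom_k(A, k)`. -/
def CanonicalModule (k A : Type*) [Field k] [CommRing A] [Algebra k A] : Type _ :=
  A →ₗ[k] k

variable (k : Type*) [Field k] {n : ℕ} {A : Type*} [CommRing A] [Algebra k A]

instance : AddCommGroup (CanonicalModule k A) := inferInstanceAs (AddCommGroup (A →ₗ[k] k))

instance : Module k (CanonicalModule k A) := inferInstanceAs (Module k (A →ₗ[k] k))

instance : FunLike (CanonicalModule k A) A k := inferInstanceAs (FunLike (A →ₗ[k] k) A k)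

/-- The `A`-module structure of `ω_A`: `(f • φ)(g) = φ(f * g)`. -/
instance : Module A (CanonicalModule k A) where
  smul f φ := LinearMap.comp (φ : A →ₗ[k] k) (LinearMap.mulLeft k f)
  one_smul φ := LinearMap.ext fun g => congrArg (φ : A →ₗ[k] k) (one_mul g)
  mul_smul a b φ := LinearMap.ext fun g =>
    congrArg (φ : A →ₗ[k] k) (show a * b * g = b * (a * g) by ring)
  smul_zero _ := rfl
  smul_add _ _ _ := rfl
  add_smul a b φ := LinearMap.ext fun g =>
    (congrArg (φ : A →ₗ[k] k) (add_mul a b g)).trans (LinearMap.map_add (φ : A →ₗ[k] k) _ _)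
  zero_smul φ := LinearMap.ext fun g =>
    (congrArg (φ : A →ₗ[k] k) (zero_mul g)).trans (LinearMap.map_zero (φ : A →ₗ[k] k))

theorem CanonicalModule.smul_apply (f g : A) (φ : CanonicalModule k A) :
    (f • φ) g = φ (f * g) := rfl

/-- The degree filtration of `ω_A`: `G_i ω_A = {φ | φ(F_{-i-1} A) = 0}`. -/
def canonicalFiltration (x : Fin n → A) (i : ℤ) : Set (CanonicalModule k A) :=
  {φ | ∀ f ∈ degreeFiltration k x (-i - 1), φ f = 0}

/-- The order of a (non-zero) element of `ω_A` with respect to the degree filtration. -/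
def canonicalOrder (x : Fin n → A) (φ : CanonicalModule k A) : ℤ :=
  sInf {i : ℤ | φ ∈ canonicalFiltration k x i}

/-- There is `φ ∈ ω_A` of order `-ri(A)` with `Ann_A(φ) = 0`. -/
def HasFaithfulFormOfLeastOrder (x : Fin n → A) : Prop :=
  ∃ φ : CanonicalModule k A,
    canonicalOrder k x φ = -regularityIndex k x ∧
      Ideal.torsionOf A (CanonicalModule k A) φ = ⊥

end Canonical

section Gorenstein

/-- A zero-dimensional local ring `(A, 𝔪)` is Gorenstein if its socle `Ann_A(𝔪)` has
dimension one over `A/𝔪`. -/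
def IsGorensteinLocal (A : Type*) [CommRing A] : Prop :=
  ∃ _ : IsLocalRing A,
    Module.finrank (A ⧸ IsLocalRing.maximalIdeal A)
      (Submodule.torsionBySet A A (IsLocalRing.maximalIdeal A)) = 1

/-- A zero-dimensional Noetherian ring is locally Gorenstein if its quotients by the primary
components of the zero ideal are Gorenstein local rings. (In dimension zero the minimal primary
decomposition `t` exists and is unique.) -/
def IsLocallyGorenstein (R : Type*) [CommRing R] : Prop :=
  ∀ t : Finset (Ideal R), Submodule.IsMinimalPrimaryDecomposition (⊥ : Ideal R) t →
    ∀ q ∈ t, IsGorensteinLocal (R ⧸ q)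

end Gorenstein

section CBP

variable {K : Type*} [Field K] {n : ℕ} (I : Ideal (MvPolynomial (Fin n) K))

/-- The residue classes of the indeterminates in `P/I`. -/
def coords (j : Fin n) : MvPolynomial (Fin n) K ⧸ I := Ideal.Quotient.mk I (MvPolynomial.X j)

open Classical in
/-- Let `t` be the set of primary components of `I` and `Q ∈ t`. A `Q`-divisor of `I` is an
ideal obtained from the intersection of all components by replacing `Q` with a strictly larger
ideal `Q'`. Here `Q' = P` is possible; this is needed when `Q` is maximal. -/
def IsDivisor (t : Finset (Ideal (MvPolynomial (Fin n) K)))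
    (Q J : Ideal (MvPolynomial (Fin n) K)) : Prop :=
  ∃ Q' : Ideal (MvPolynomial (Fin n) K), Q < Q' ∧ J = Q' ⊓ (t.erase Q).inf id

/-- A minimal `Q`-divisor of `I`: a `Q`-divisor `J` with `dim_K (J/I) = dim_K (P/Rad(Q))`. -/
def IsMinimalDivisor (t : Finset (Ideal (MvPolynomial (Fin n) K)))
    (Q J : Ideal (MvPolynomial (Fin n) K)) : Prop :=
  IsDivisor t Q J ∧
    Module.finrank K (J.map (Ideal.Quotient.mk I)) =
      Module.finrank K (MvPolynomial (Fin n) K ⧸ Q.radical)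

/-- The separator degree of the maximal ideal of `P/I` which belongs to the component `Q`. -/
def separatorDegree (t : Finset (Ideal (MvPolynomial (Fin n) K)))
    (Q : Ideal (MvPolynomial (Fin n) K)) : ℤ :=
  sInf {r : ℤ | ∃ J : Ideal (MvPolynomial (Fin n) K), IsMinimalDivisor I t Q J ∧
    idealRegularityIndex K (coords I) (J.map (Ideal.Quotient.mk I)) = r}

/-- The Cayley-Bacharach property of `P/I`: all separator degrees are equal to the
regularity index. (For zero-dimensional `I`, the minimal primary decomposition `t` exists and is
unique.) -/
def HasCayleyBacharachProperty : Prop :=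
  ∀ t : Finset (Ideal (MvPolynomial (Fin n) K)), Submodule.IsMinimalPrimaryDecomposition I t →
    ∀ Q ∈ t, separatorDegree I t Q = regularityIndex K (coords I)

/-- The generators `1 ⊗ x_j` of the affine `L`-algebra
`R_L = L ⊗_K (P/I) ≅ L[x₁, …, xₙ]/I L[x₁, …, xₙ]`. -/
def coordsBaseChange (L : Type*) [Field L] [Algebra K L] (j : Fin n) :
    L ⊗[K] (MvPolynomial (Fin n) K ⧸ I) :=
  1 ⊗ₜ[K] coords I j

end CBP

end CayleyBacharach

end

/- A functional `φ` has annihilator `0` if and only if `ker φ` contains no nonzero ideal, and the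
Cayley-Bacharach property says that `F = F_{ri(R)-1} R` contains no nonzero ideal. Both conditions
only need to be tested on minimal ideals, and `R` is locally Gorenstein if and only if every socle
`Ann(𝔪)` is a minimal ideal; since the socles are independent, there is then a functional `σ`
vanishing on none of them, and it has annihilator `0`. The orthogonal space of `F` under
`(a, b) ↦ σ (a b)` lies in no maximal ideal `𝔪`, as otherwise `Ann(𝔪) ⊆ F`. Hence over an infinite
field it contains a unit `w`, and `φ = w σ` is the functional sought. Conversely, under the form of
a functional on `R_L` with annihilator `0`, the scalar extension of `Ann(𝔪)` is orthogonal to that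
of `𝔪`, so `dim_K Ann(𝔪) ≤ dim_K R/𝔪` and `Ann(𝔪)` is a minimal ideal. The two directions fit
together because `F` is spanned by monomials and so commutes with the extension of scalars. -/

namespace CayleyBacharach

section Filtration

variable {k : Type*} [Field k] {n : ℕ} {A : Type*} [CommRing A] [Algebra k A] (x : Fin n → A)

theorem csInf_le_iff_mem_of_isUpperSet {S : Set ℤ} (hS : IsUpperSet S) (hne : S.Nonempty)
    (hbdd : BddBelow S) {i : ℤ} : sInf S ≤ i ↔ i ∈ S :=
  ⟨fun h => hS h (Int.csInf_mem hne hbdd), fun h => csInf_le hbdd h⟩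

theorem degreeFiltration_mono : Monotone (degreeFiltration k x) := by
  intro i j hij
  refine Submodule.map_mono ?_
  rintro f (hf | hf)
  · exact Or.inl hf
  · exact Or.inr (hf.trans hij)

theorem degreeFiltration_of_neg {i : ℤ} (hi : i < 0) : degreeFiltration k x i = ⊥ := by
  rw [eq_bot_iff]
  rintro _ ⟨f, hf | hf, rfl⟩
  · simp [hf]
  · omega

theorem nonneg_of_mem_degreeFiltration {a : A} (ha : a ≠ 0) {i : ℤ}
    (hi : a ∈ degreeFiltration k x i) : 0 ≤ i := by
  by_contra! hneg
  rw [degreeFiltration_of_neg x hneg] at hi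
  exact ha hi

variable {x}

theorem exists_mem_degreeFiltration (hx : Algebra.adjoin k (Set.range x) = ⊤) (a : A) :
    ∃ i : ℤ, a ∈ degreeFiltration k x i := by
  rw [Algebra.adjoin_range_eq_range_aeval, AlgHom.range_eq_top] at hx
  obtain ⟨p, rfl⟩ := hx a
  exact ⟨p.totalDegree, p, Or.inr le_rfl, rfl⟩

theorem mem_degreeFiltration_iff_order_le (hx : Algebra.adjoin k (Set.range x) = ⊤) {a : A}
    (ha : a ≠ 0) {i : ℤ} : a ∈ degreeFiltration k x i ↔ order k x a ≤ i := by
  set S : Set ℤ := {i | a ∈ degreeFiltration k x i}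
  have hS : IsUpperSet S := fun i j hij hi => degreeFiltration_mono x hij hi
  have hbdd : BddBelow S := ⟨0, fun i hi => nonneg_of_mem_degreeFiltration x ha hi⟩
  have hmem (i : ℤ) : sInf S ≤ i ↔ i ∈ S :=
    csInf_le_iff_mem_of_isUpperSet hS (exists_mem_degreeFiltration hx a) hbdd
  have hjump : {i | i ∈ S ∧ i - 1 ∉ S} = {sInf S} := by
    ext i
    simp only [← hmem, Set.mem_ofPred_eq, Set.mem_singleton_iff]
    omega
  have horder : order k x a = sInf S := (congrArg sInf hjump).trans (csInf_singleton _)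
  rw [horder, hmem]
  rfl

variable [Module.Finite k A]

theorem exists_degreeFiltration_eq_top (hx : Algebra.adjoin k (Set.range x) = ⊤) :
    ∃ i : ℤ, degreeFiltration k x i = ⊤ := by
  choose i hi using exists_mem_degreeFiltration hx
  let b := Module.finBasis k A
  obtain ⟨N, hN⟩ := Finite.exists_le (i ∘ b)
  refine ⟨N, eq_top_iff.2 (b.span_eq.ge.trans (Submodule.span_le.2 ?_))⟩
  rintro _ ⟨j, rfl⟩
  exact degreeFiltration_mono x (hN j) (hi (b j))

theorem degreeFiltration_eq_top_iff [Nontrivial A] (hx : Algebra.adjoin k (Set.range x) = ⊤)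
    {i : ℤ} : degreeFiltration k x i = ⊤ ↔ regularityIndex k x ≤ i := by
  have hS : {i : ℤ | ∀ j, i ≤ j → hilbertFunction k x j = Module.finrank k A} =
      {i | degreeFiltration k x i = ⊤} := by
    ext i
    refine ⟨fun h => Submodule.eq_top_of_finrank_eq (h i le_rfl), fun h j hij => ?_⟩
    rw [hilbertFunction, top_le_iff.1 (h.ge.trans (degreeFiltration_mono x hij)), finrank_top]
  rw [regularityIndex, hS]
  refine (csInf_le_iff_mem_of_isUpperSet ?_ (exists_degreeFiltration_eq_top hx) ?_).symm
  · exact fun i j hij hi => top_le_iff.1 (hi.ge.trans (degreeFiltration_mono x hij))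
  · exact ⟨0, fun i hi => nonneg_of_mem_degreeFiltration x one_ne_zero (hi.ge trivial)⟩

theorem canonicalOrder_le_iff (hx : Algebra.adjoin k (Set.range x) = ⊤) {φ : A →ₗ[k] k}
    (hφ : φ ≠ 0) {i : ℤ} :
    canonicalOrder k x φ ≤ i ↔ degreeFiltration k x (-i - 1) ≤ LinearMap.ker φ := by
  refine csInf_le_iff_mem_of_isUpperSet (S := {i | φ ∈ canonicalFiltration k x i}) ?_ ?_ ?_
  · exact fun i j hij hi f hf => hi f (degreeFiltration_mono x (by omega) hf)
  · refine ⟨0, fun f hf => ?_⟩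
    rw [degreeFiltration_of_neg x (by norm_num)] at hf
    exact (congrArg φ hf).trans (map_zero φ)
  · obtain ⟨N, hN⟩ := exists_degreeFiltration_eq_top hx
    refine ⟨-N, fun i hi => ?_⟩
    by_contra! hlt
    refine hφ (LinearMap.ext fun a => hi a (degreeFiltration_mono x ?_ (hN.ge trivial)))
    omega

theorem canonicalOrder_eq_neg_regularityIndex_iff [Nontrivial A]
    (hx : Algebra.adjoin k (Set.range x) = ⊤) {φ : A →ₗ[k] k} (hφ : φ ≠ 0) :
    canonicalOrder k x φ = -regularityIndex k x ↔
      degreeFiltration k x (regularityIndex k x - 1) ≤ LinearMap.ker φ := by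
  have hlower : -regularityIndex k x ≤ canonicalOrder k x φ := by
    by_contra! hlt
    have hker := (canonicalOrder_le_iff hx hφ).1 (Int.le_sub_one_of_lt hlt)
    rw [(degreeFiltration_eq_top_iff hx).2 (by omega), top_le_iff, LinearMap.ker_eq_top] at hker
    exact hφ hker
  rw [← hlower.ge_iff_eq', canonicalOrder_le_iff hx hφ, neg_neg]

theorem idealRegularityIndex_le_iff (hx : Algebra.adjoin k (Set.range x) = ⊤) {J : Ideal A}
    (hJ : J ≠ ⊥) {i : ℤ} :
    idealRegularityIndex k x J ≤ i ↔ J.restrictScalars k ≤ degreeFiltration k x i := by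
  obtain ⟨b, hbJ, hb⟩ := J.ne_bot_iff.1 hJ
  obtain ⟨N, hN⟩ := exists_degreeFiltration_eq_top hx
  have hbdd : BddAbove {r : ℤ | ∃ f ∈ J, f ≠ 0 ∧ order k x f = r} := by
    refine ⟨N, ?_⟩
    rintro _ ⟨f, -, hf, rfl⟩
    exact (mem_degreeFiltration_iff_order_le hx hf).1 (hN.ge trivial)
  rw [idealRegularityIndex, csSup_le_iff hbdd ⟨_, b, hbJ, hb, rfl⟩]
  constructor
  · intro h a ha
    obtain rfl | ha0 := eq_or_ne a 0
    · exact zero_mem _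
    · exact (mem_degreeFiltration_iff_order_le hx ha0).2 (h _ ⟨a, ha, ha0, rfl⟩)
  · rintro h _ ⟨a, ha, ha0, rfl⟩
    exact (mem_degreeFiltration_iff_order_le hx ha0).1 (h ha)

theorem idealRegularityIndex_nonneg (hx : Algebra.adjoin k (Set.range x) = ⊤) {J : Ideal A}
    (hJ : J ≠ ⊥) : 0 ≤ idealRegularityIndex k x J := by
  obtain ⟨b, hbJ, hb⟩ := J.ne_bot_iff.1 hJ
  exact nonneg_of_mem_degreeFiltration x hb ((idealRegularityIndex_le_iff hx hJ).1 le_rfl hbJ)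

theorem idealRegularityIndex_le_regularityIndex [Nontrivial A]
    (hx : Algebra.adjoin k (Set.range x) = ⊤) {J : Ideal A} (hJ : J ≠ ⊥) :
    idealRegularityIndex k x J ≤ regularityIndex k x := by
  rw [idealRegularityIndex_le_iff hx hJ, (degreeFiltration_eq_top_iff hx).2 le_rfl]
  exact le_top

theorem idealRegularityIndex_eq_regularityIndex_iff [Nontrivial A]
    (hx : Algebra.adjoin k (Set.range x) = ⊤) {J : Ideal A} (hJ : J ≠ ⊥) :
    idealRegularityIndex k x J = regularityIndex k x ↔
      ¬ J.restrictScalars k ≤ degreeFiltration k x (regularityIndex k x - 1) := by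
  have hle := idealRegularityIndex_le_regularityIndex hx hJ
  rw [← idealRegularityIndex_le_iff hx hJ]
  omega

end Filtration

section IdealFree

variable {k : Type*} [Field k] {A : Type*} [CommRing A] [Algebra k A]

/-- A subspace `F` of a `k`-algebra `A` is ideal-free if `0` is the only ideal contained in it.
Both halves of the theorem are about this notion: `ker φ` is ideal-free if and only if
`Ann_A(φ) = 0`, and the Cayley-Bacharach property of `R` says that `F_{ri(R)-1} R` is
ideal-free. -/
def IsIdealFree (F : Submodule k A) : Prop :=
  ∀ J : Ideal A, J.restrictScalars k ≤ F → J = ⊥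

theorem isIdealFree_iff {F : Submodule k A} :
    IsIdealFree F ↔ ∀ a, (∀ g, a * g ∈ F) → a = 0 := by
  refine ⟨fun hF a ha => ?_, fun h J hJ => ?_⟩
  · refine Ideal.span_singleton_eq_bot.1 (hF (Ideal.span {a}) fun b hb => ?_)
    obtain ⟨g, rfl⟩ := Ideal.mem_span_singleton'.1 hb
    exact mul_comm a g ▸ ha g
  · exact (Submodule.eq_bot_iff J).2 fun a ha => h a fun g => hJ (J.mul_mem_right g ha)

theorem IsIdealFree.mono {F G : Submodule k A} (hG : IsIdealFree G) (h : F ≤ G) : IsIdealFree F :=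
  fun J hJ => hG J (hJ.trans h)

theorem IsIdealFree.ne_zero [Nontrivial A] {φ : A →ₗ[k] k} (hφ : IsIdealFree (LinearMap.ker φ)) :
    φ ≠ 0 := by
  rintro rfl
  exact top_ne_bot (hφ ⊤ (LinearMap.ker_zero.ge.trans' le_top))

theorem isIdealFree_iff_of_isAtomic [IsAtomic (Ideal A)] {F : Submodule k A} :
    IsIdealFree F ↔ ∀ S : Ideal A, IsAtom S → ¬ S.restrictScalars k ≤ F := by
  refine ⟨fun hF S hS hle => hS.1 (hF S hle), fun h J hJ => ?_⟩
  obtain hbot | ⟨S, hS, hSJ⟩ := eq_bot_or_exists_atom_le J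
  · exact hbot
  · exact (h S hS (hJ.trans' hSJ)).elim

theorem torsionOf_eq_bot_iff_isIdealFree_ker {φ : A →ₗ[k] k} :
    Ideal.torsionOf A (CanonicalModule k A) φ = ⊥ ↔ IsIdealFree (LinearMap.ker φ) := by
  have hmem (a : A) :
      a ∈ Ideal.torsionOf A (CanonicalModule k A) φ ↔ ∀ g, a * g ∈ LinearMap.ker φ :=
    LinearMap.ext_iff (f := φ ∘ₗ LinearMap.mulLeft k a) (g := 0)
  simp only [isIdealFree_iff, Submodule.eq_bot_iff, hmem]

theorem hasFaithfulFormOfLeastOrder_iff [Module.Finite k A] [Nontrivial A] {n : ℕ} {x : Fin n → A}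
    (hx : Algebra.adjoin k (Set.range x) = ⊤) :
    HasFaithfulFormOfLeastOrder k x ↔ ∃ φ : A →ₗ[k] k,
      degreeFiltration k x (regularityIndex k x - 1) ≤ LinearMap.ker φ ∧
        IsIdealFree (LinearMap.ker φ) :=
  exists_congr fun _ : A →ₗ[k] k =>
    (and_congr_right' torsionOf_eq_bot_iff_isIdealFree_ker).trans
      (and_congr_left fun hφ => canonicalOrder_eq_neg_regularityIndex_iff hx hφ.ne_zero)

end IdealFree

section BaseChange

variable {k : Type*} [Field k] {A : Type*} [CommRing A] [Algebra k A]
  (L : Type*) [Field L] [Algebra k L]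

theorem polyFiltration_eq_restrictSupport (k : Type*) [Field k] (n : ℕ) (i : ℤ) :
    polyFiltration k n i = MvPolynomial.restrictSupport k {d | (d.degree : ℤ) ≤ i} := by
  ext p
  rw [MvPolynomial.mem_restrictSupport_iff]
  constructor
  · rintro (rfl | hp) d hd
    · simp at hd
    · exact (Int.ofNat_le.2 (MvPolynomial.le_totalDegree hd)).trans hp
  · intro hp
    refine or_iff_not_imp_left.2 fun hp0 => ?_
    obtain ⟨d, hd, hdeg⟩ := Finset.exists_mem_eq_sup _ (MvPolynomial.support_nonempty.2 hp0)
      fun d => d.sum fun _ e => e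
    exact (Int.ofNat_le.2 hdeg.le).trans (hp hd)

theorem degreeFiltration_eq_span {n : ℕ} (x : Fin n → A) (i : ℤ) :
    degreeFiltration k x i =
      Submodule.span k ((fun d => d.prod fun j e => x j ^ e) ''
        {d : Fin n →₀ ℕ | (d.degree : ℤ) ≤ i}) := by
  rw [degreeFiltration, polyFiltration_eq_restrictSupport, MvPolynomial.restrictSupport_eq_span,
    Submodule.map_span, Set.image_image]
  simp [MvPolynomial.aeval_monomial]

theorem degreeFiltration_baseChange {n : ℕ} (x : Fin n → A) (i : ℤ) :
    degreeFiltration L (fun j => (1 : L) ⊗ₜ[k] x j) i = (degreeFiltration k x i).baseChange L := by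
  rw [degreeFiltration_eq_span, degreeFiltration_eq_span, Submodule.baseChange_span,
    Set.image_image]
  refine congrArg _ (Set.image_congr' fun d => ?_)
  simp only [Algebra.TensorProduct.tmul_pow, one_pow]
  exact (map_finsuppProd (Algebra.TensorProduct.includeRight : A →ₐ[k] L ⊗[k] A) d _).symm

theorem finrank_submodule_baseChange (F : Submodule k A) :
    Module.finrank L (F.baseChange L) = Module.finrank k F := by
  rw [Submodule.baseChange, LinearMap.finrank_range_of_inj, Module.finrank_baseChange]
  exact Module.Flat.lTensor_preserves_injective_linearMap _ F.injective_subtype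

theorem regularityIndex_baseChange {n : ℕ} (x : Fin n → A) :
    regularityIndex L (fun j => (1 : L) ⊗ₜ[k] x j) = regularityIndex k x := by
  have hHF (j : ℤ) : hilbertFunction L (fun j => (1 : L) ⊗ₜ[k] x j) j = hilbertFunction k x j := by
    rw [hilbertFunction, degreeFiltration_baseChange, finrank_submodule_baseChange, hilbertFunction]
  simp only [regularityIndex, hHF, Module.finrank_baseChange]

theorem adjoin_one_tmul_eq_top {n : ℕ} {x : Fin n → A}
    (hx : Algebra.adjoin k (Set.range x) = ⊤) :
    Algebra.adjoin L (Set.range fun j => (1 : L) ⊗ₜ[k] x j) = ⊤ := by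
  rw [← Algebra.TensorProduct.adjoin_one_tmul_image_eq_top _ hx, ← Set.range_comp]
  rfl

theorem coord_mem_of_mem_baseChange {ι : Type*} [DecidableEq ι] (b : Module.Basis ι k L)
    {F : Submodule k A} {a : L ⊗[k] A} (ha : a ∈ F.baseChange L) (l : ι) :
    TensorProduct.equivFinsuppOfBasisLeft b a l ∈ F := by
  obtain ⟨a, rfl⟩ := ha
  induction a with
  | zero => simp
  | tmul c f => simpa using F.smul_mem _ f.2
  | add a a' h h' => simpa using F.add_mem h h'

theorem coord_mul_one_tmul {ι : Type*} [DecidableEq ι] (b : Module.Basis ι k L)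
    (a : L ⊗[k] A) (g : A) (l : ι) :
    TensorProduct.equivFinsuppOfBasisLeft b (a * 1 ⊗ₜ g) l =
      TensorProduct.equivFinsuppOfBasisLeft b a l * g := by
  induction a with
  | zero => simp
  | tmul c a => simp
  | add a a' h h' => simp [add_mul, h, h']

theorem IsIdealFree.baseChange {F : Submodule k A} (hF : IsIdealFree F) :
    IsIdealFree (F.baseChange L) := by
  classical
  let b := Module.Basis.ofVectorSpace k L
  rw [isIdealFree_iff] at hF ⊢
  intro a ha
  rw [← (TensorProduct.equivFinsuppOfBasisLeft b).map_eq_zero_iff]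
  ext l
  refine hF _ fun g => ?_
  rw [← coord_mul_one_tmul]
  exact coord_mem_of_mem_baseChange L b (ha _) l

theorem IsIdealFree.of_baseChange {F : Submodule k A} (hF : IsIdealFree (F.baseChange L)) :
    IsIdealFree F := by
  rw [isIdealFree_iff] at hF ⊢
  intro a ha
  suffices (1 : L) ⊗ₜ[k] a = 0 from
    Algebra.TensorProduct.includeRight_injective (algebraMap k L).injective
      (this.trans (TensorProduct.tmul_zero A 1).symm)
  refine hF _ fun g => ?_
  induction g with
  | zero => simp
  | tmul c g =>
    rw [Algebra.TensorProduct.tmul_mul_tmul, one_mul]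
    exact Submodule.tmul_mem_baseChange_of_mem c (ha g)
  | add g g' h h' =>
    rw [mul_add]
    exact add_mem h h'

theorem mul_eq_zero_of_mem_baseChange {F G : Submodule k A}
    (h : ∀ a ∈ F, ∀ b ∈ G, a * b = 0) {a b : L ⊗[k] A} (ha : a ∈ F.baseChange L)
    (hb : b ∈ G.baseChange L) : a * b = 0 := by
  rw [Submodule.baseChange_eq_span] at ha hb
  induction ha, hb using Submodule.span_induction₂ with
  | mem_mem a b ha hb =>
    obtain ⟨a, ha, rfl⟩ := ha
    obtain ⟨b, hb, rfl⟩ := hb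
    simp [h a ha b hb]
  | zero_left => simp
  | zero_right => simp
  | add_left a a' b _ _ _ h h' => simp [add_mul, h, h']
  | add_right a b b' _ _ _ h h' => simp [mul_add, h, h']
  | smul_left c a b _ _ h => simp [h]
  | smul_right c a b _ _ h => simp [h]

theorem exists_ker_eq_baseChange_ker (φ : A →ₗ[k] k) :
    ∃ ψ : L ⊗[k] A →ₗ[L] L, LinearMap.ker ψ = (LinearMap.ker φ).baseChange L := by
  let e := TensorProduct.AlgebraTensorModule.rid k L L
  refine ⟨e.toLinearMap ∘ₗ φ.baseChange L, ?_⟩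
  rw [LinearEquiv.ker_comp]
  exact Module.Flat.ker_lTensor_eq L L φ

end BaseChange

section MulForm

variable {k : Type*} [Field k] {A : Type*} [CommRing A] [Algebra k A]

/-- The bilinear form `(a, b) ↦ σ (a * b)` of a functional `σ`. It is nondegenerate if and only if
`ker σ` is ideal-free, and then its orthogonality relation dualizes ideals of `A`. -/
noncomputable def mulForm (σ : A →ₗ[k] k) : LinearMap.BilinForm k A :=
  (LinearMap.mul k A).compr₂ σ

theorem mulForm_isRefl (σ : A →ₗ[k] k) : (mulForm σ).IsRefl :=
  fun a b h => (congrArg σ (mul_comm b a)).trans h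

theorem IsIdealFree.mulForm_nondegenerate {σ : A →ₗ[k] k} (hσ : IsIdealFree (LinearMap.ker σ)) :
    (mulForm σ).Nondegenerate :=
  (mulForm_isRefl σ).nondegenerate_iff_separatingLeft.2 (isIdealFree_iff.1 hσ)

theorem annihilator_ne_bot_of_ne_top {R : Type*} [CommRing R] [IsArtinianRing R] {J : Ideal R}
    (hJ : J ≠ ⊤) : J.annihilator ≠ ⊥ := by
  refine (Ideal.bot_lt_annihilator_of_disjoint_nonZeroDivisors ?_).ne'
  refine Set.disjoint_left.2 fun a haJ ha => hJ ?_
  exact J.eq_top_of_isUnit_mem haJ (IsArtinianRing.isUnit_of_mem_nonZeroDivisors ha)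

theorem exists_isUnit_mem_of_forall_not_le [Infinite k] [Finite (MaximalSpectrum A)]
    {W : Submodule k A} (hW : ∀ m : Ideal A, m.IsMaximal → ¬ W ≤ m.restrictScalars k) :
    ∃ w ∈ W, IsUnit w := by
  by_contra! hnu
  have hcover : ⋃ m : MaximalSpectrum A,
      ((m.asIdeal.restrictScalars k).comap W.subtype : Set W) = Set.univ := by
    refine Set.eq_univ_of_forall fun w => Set.mem_iUnion.2 ?_
    obtain ⟨m, hm, hwm⟩ := exists_max_ideal_of_mem_nonunits (hnu w w.2)
    exact ⟨⟨m, hm⟩, hwm⟩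
  obtain ⟨m, hm⟩ := Subspace.exists_eq_top_of_iUnion_eq_univ hcover
  exact hW m.asIdeal m.isMaximal (Submodule.comap_subtype_eq_top.1 hm)

theorem IsIdealFree.exists_le_ker [Infinite k] [Module.Finite k A] {σ : A →ₗ[k] k}
    (hσ : IsIdealFree (LinearMap.ker σ)) {F : Submodule k A} (hF : IsIdealFree F) :
    ∃ φ : A →ₗ[k] k, F ≤ LinearMap.ker φ ∧ IsIdealFree (LinearMap.ker φ) := by
  have : IsArtinianRing A := IsArtinianRing.of_finite k A
  have hW (m : Ideal A) (hm : m.IsMaximal) :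
      ¬ (mulForm σ).orthogonal F ≤ m.restrictScalars k := by
    intro hle
    refine annihilator_ne_bot_of_ne_top hm.ne_top (hF _ fun a ha => ?_)
    rw [← LinearMap.BilinForm.orthogonal_orthogonal hσ.mulForm_nondegenerate (mulForm_isRefl σ) F]
    intro w hw
    have hwa : a * w = 0 := Submodule.mem_annihilator.1 ha w (hle hw)
    exact (congrArg σ ((mul_comm w a).trans hwa)).trans (map_zero σ)
  obtain ⟨w, hwF, hw⟩ := exists_isUnit_mem_of_forall_not_le hW
  refine ⟨mulForm σ w, fun f hf => mulForm_isRefl σ _ _ (hwF f hf), ?_⟩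
  rw [isIdealFree_iff] at hσ ⊢
  intro a ha
  refine hw.mul_right_eq_zero.1 (hσ _ fun g => ?_)
  rw [mul_assoc]
  exact ha g

end MulForm

section Socle

/-- Every socle `Ann_R(𝔪)`, for `𝔪` a maximal ideal of `R`, is a minimal ideal. This is how the
locally Gorenstein property of an Artinian ring is used; no decomposition of `R` is involved. -/
def HasSimpleSocles (R : Type*) [CommRing R] : Prop :=
  ∀ m : Ideal R, m.IsMaximal → IsAtom m.annihilator

theorem le_annihilator_comm {R : Type*} [CommSemiring R] {I J : Ideal R} :
    I ≤ J.annihilator ↔ J ≤ I.annihilator := by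
  rw [Submodule.le_annihilator_iff, Submodule.le_annihilator_iff, Ideal.smul_eq_mul,
    Ideal.smul_eq_mul, mul_comm]

theorem annihilator_eq_torsionBySet {R : Type*} [CommRing R] (J : Ideal R) :
    J.annihilator = Submodule.torsionBySet R R J := by
  ext a
  simp [Submodule.mem_annihilator, mul_comm a]

theorem iSupIndep_annihilator (R : Type*) [CommRing R] :
    iSupIndep fun m : MaximalSpectrum R => m.asIdeal.annihilator := by
  simp only [annihilator_eq_torsionBySet]
  exact iSupIndep_iff_supIndep.2 fun s => Submodule.supIndep_torsionBySet_ideal fun m _ m' _ hne =>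
    m.isMaximal.coprime_of_ne m'.isMaximal (mt MaximalSpectrum.ext hne)

theorem nonempty_linearEquiv_quotient_annihilator (R M : Type*) [CommRing R] [AddCommGroup M]
    [Module R M] [IsSimpleModule R M] : Nonempty (M ≃ₗ[R] R ⧸ Module.annihilator R M) := by
  obtain ⟨m, -, ⟨e⟩⟩ := isSimpleModule_iff_quot_maximal.1 ‹IsSimpleModule R M›
  rw [e.annihilator_eq, Ideal.annihilator_quotient]
  exact ⟨e⟩

theorem finrank_eq_finrank_quotient_of_isSimpleModule (k : Type*) [Field k] {R M : Type*}
    [CommRing R] [Algebra k R] [AddCommGroup M] [Module k M] [Module R M] [IsScalarTower k R M]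
    [IsSimpleModule R M] {m : Ideal R} (hm : m.IsMaximal) (h : m ≤ Module.annihilator R M) :
    Module.finrank k M = Module.finrank k (R ⧸ m) := by
  obtain ⟨e⟩ := nonempty_linearEquiv_quotient_annihilator R M
  rw [hm.eq_of_le IsSimpleModule.annihilator_isMaximal.ne_top h]
  exact (e.restrictScalars k).finrank_eq

variable {k : Type*} [Field k] {A : Type*} [CommRing A] [Algebra k A] [Module.Finite k A]

theorem HasSimpleSocles.exists_isIdealFree_ker (h : HasSimpleSocles A) :
    ∃ σ : A →ₗ[k] k, IsIdealFree (LinearMap.ker σ) := by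
  have : IsArtinianRing A := IsArtinianRing.of_finite k A
  choose v hv hv0 using fun m : MaximalSpectrum A =>
    Submodule.exists_mem_ne_zero_of_ne_bot (h m.asIdeal m.isMaximal).1
  have hli : LinearIndependent k v := by
    rw [linearIndependent_iff']
    intro s c hc m hm
    have hcv := (iSupIndep_iff_finsetSum_eq_zero_imp_eq_zero _).1 (iSupIndep_annihilator A) s
      (fun m => c m • v m) (fun m _ => Submodule.smul_of_tower_mem _ _ (hv m)) hc m hm
    exact (smul_eq_zero_iff_left (hv0 m)).1 hcv
  obtain ⟨σ, hσ⟩ := Module.exists_dual_forall_apply_eq_one (hli.linearIndepOn Set.univ)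
  refine ⟨σ, isIdealFree_iff_of_isAtomic.2 fun S hS hle => ?_⟩
  have : IsSimpleModule A S := isSimpleModule_iff_isAtom.2 hS
  let m : MaximalSpectrum A := ⟨S.annihilator, IsSimpleModule.annihilator_isMaximal⟩
  have hSm : S = m.asIdeal.annihilator :=
    ((h _ m.isMaximal).le_iff_eq hS.1).1 (le_annihilator_comm.1 le_rfl)
  exact one_ne_zero ((hσ m trivial).symm.trans (hle (hSm.ge (hv m))))

theorem finrank_annihilator_le_of_isIdealFree_ker {L : Type*} [Field L] [Algebra k L]
    {φ : L ⊗[k] A →ₗ[L] L} (hφ : IsIdealFree (LinearMap.ker φ)) (J : Ideal A) :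
    Module.finrank k J.annihilator ≤ Module.finrank k (A ⧸ J) := by
  have hle : (J.annihilator.restrictScalars k).baseChange L ≤
      (mulForm φ).orthogonal ((J.restrictScalars k).baseChange L) := by
    intro b hb a ha
    have hab : a * b = 0 := mul_eq_zero_of_mem_baseChange L (fun a ha b hb => by
      rw [mul_comm]
      exact Submodule.mem_annihilator.1 hb a ha) ha hb
    exact (congrArg φ hab).trans (map_zero φ)
  have hfinrank := Submodule.finrank_mono hle
  rw [LinearMap.BilinForm.finrank_orthogonal hφ.mulForm_nondegenerate,
    finrank_submodule_baseChange, finrank_submodule_baseChange, Module.finrank_baseChange,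
    ← Submodule.finrank_quotient] at hfinrank
  exact hfinrank

theorem hasSimpleSocles_of_isIdealFree_ker_baseChange {L : Type*} [Field L] [Algebra k L]
    {φ : L ⊗[k] A →ₗ[L] L} (hφ : IsIdealFree (LinearMap.ker φ)) : HasSimpleSocles A := by
  intro m hm
  have : IsArtinianRing A := IsArtinianRing.of_finite k A
  obtain hbot | ⟨S, hS, hSm⟩ := eq_bot_or_exists_atom_le m.annihilator
  · exact (annihilator_ne_bot_of_ne_top hm.ne_top hbot).elim
  have : IsSimpleModule A S := isSimpleModule_iff_isAtom.2 hS
  have hrank := (finrank_annihilator_le_of_isIdealFree_ker hφ m).trans_eq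
    (finrank_eq_finrank_quotient_of_isSimpleModule k hm (le_annihilator_comm.1 hSm)).symm
  have hSeq : S.restrictScalars k = m.annihilator.restrictScalars k :=
    Submodule.eq_of_le_of_finrank_le hSm hrank
  exact Submodule.restrictScalars_injective k _ _ hSeq ▸ hS

end Socle

section PrimaryDecomposition

variable {R : Type*} [CommRing R] {I : Ideal R} {t : Finset (Ideal R)}

theorem eq_radical_of_mul_le {Q m J : Ideal R} (hQ : Q.IsPrimary) (hm : m.IsMaximal)
    (hmJ : m * J ≤ Q) (hJ : ¬ J ≤ Q) : m = Q.radical := by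
  obtain ⟨a, haJ, haQ⟩ := SetLike.not_le_iff_exists.1 hJ
  refine hm.eq_of_le (Ideal.isPrime_radical hQ).ne_top fun r hr => ?_
  have har : a * r ∈ Q := hmJ (mul_comm r a ▸ Ideal.mul_mem_mul hr haJ)
  exact ((Ideal.isPrimary_iff.1 hQ).2 har).resolve_left haQ

theorem exists_mem_not_le (ht : Submodule.IsMinimalPrimaryDecomposition I t) {J : Ideal R}
    (hJ : ¬ J ≤ I) : ∃ Q ∈ t, ¬ J ≤ Q := by
  by_contra! h
  exact hJ (ht.inf_eq ▸ Finset.le_inf h)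

variable [DecidableEq (Ideal R)] {Q : Ideal R}

theorem inf_inf_erase (ht : Submodule.IsMinimalPrimaryDecomposition I t) (hQ : Q ∈ t) :
    Q ⊓ (t.erase Q).inf id = I := by
  rw [← ht.inf_eq, ← Finset.insert_erase hQ, Finset.inf_insert, Finset.erase_insert_eq_erase,
    Finset.erase_idem, id]

theorem radical_ne_of_mem_erase (ht : Submodule.IsMinimalPrimaryDecomposition I t) (hQ : Q ∈ t)
    {Q' : Ideal R} (hQ' : Q' ∈ t.erase Q) : Q'.radical ≠ Q.radical := by
  have hcolon := ht.distinct (Finset.mem_of_mem_erase hQ') hQ (Finset.ne_of_mem_erase hQ')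
  simpa only [Function.onFun, Submodule.colon_univ] using hcolon

theorem le_inf_erase_of_radical_mul_le (ht : Submodule.IsMinimalPrimaryDecomposition I t)
    (hQ : Q ∈ t) (hm : Q.radical.IsMaximal) {J : Ideal R} (hJ : Q.radical * J ≤ I) :
    J ≤ (t.erase Q).inf id := by
  refine Finset.le_inf fun Q' hQ' => ?_
  by_contra hJQ'
  have hQ't := Finset.mem_of_mem_erase hQ'
  have hIQ' : I ≤ Q' := ht.inf_eq ▸ Finset.inf_le hQ't
  exact radical_ne_of_mem_erase ht hQ hQ'
    (eq_radical_of_mul_le (ht.primary hQ't) hm (hJ.trans hIQ') hJQ').symm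

theorem sup_inf_erase_eq_top [Ring.KrullDimLE 0 R]
    (ht : Submodule.IsMinimalPrimaryDecomposition I t) (hQ : Q ∈ t) :
    Q ⊔ (t.erase Q).inf id = ⊤ := by
  by_contra hne
  obtain ⟨m, hm, hle⟩ := Ideal.exists_le_maximal _ hne
  have hradical {Q' : Ideal R} (hQ' : Q' ∈ t) (hQ'm : Q' ≤ m) : Q'.radical = m :=
    (Ideal.isPrime_radical (ht.primary hQ')).isMaximal'.eq_of_le hm.ne_top
      (hm.isPrime.radical_le_iff.2 hQ'm)
  obtain ⟨Q', hQ', hQ'm⟩ := hm.isPrime.inf_le'.1 (le_sup_right.trans hle)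
  exact radical_ne_of_mem_erase ht hQ hQ' ((hradical (Finset.mem_of_mem_erase hQ') hQ'm).trans
    (hradical hQ (le_sup_left.trans hle)).symm)

end PrimaryDecomposition

section Gorenstein

theorem isGorensteinLocal_iff_isAtom_annihilator {A : Type*} [CommRing A] [IsLocalRing A] :
    IsGorensteinLocal A ↔ IsAtom (IsLocalRing.maximalIdeal A).annihilator := by
  let _ : Field (A ⧸ IsLocalRing.maximalIdeal A) := Ideal.Quotient.field _
  rw [IsGorensteinLocal, exists_prop_of_true ‹IsLocalRing A›, ← isSimpleModule_iff_finrank_eq_one,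
    ← isSimpleModule_iff_isSimpleModule_of_algebraMap_surjective (R := A)
      Ideal.Quotient.mk_surjective,
    isSimpleModule_iff_isAtom, annihilator_eq_torsionBySet]

variable {R : Type*} [CommRing R]

theorem annihilator_le_of_codisjoint {q C : Ideal R} (h : Codisjoint q C) : q.annihilator ≤ C :=
  calc q.annihilator = q.annihilator * (q ⊔ C) := by rw [h.eq_top, Ideal.mul_top]
    _ = q.annihilator * C := by rw [Ideal.mul_sup, Submodule.annihilator_mul, bot_sup_eq]
    _ ≤ C := Ideal.mul_le_right

theorem mk_mem_annihilator_map_iff {q m : Ideal R} {a : R} :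
    Ideal.Quotient.mk q a ∈ (m.map (Ideal.Quotient.mk q)).annihilator ↔ ∀ r ∈ m, a * r ∈ q := by
  simp only [Submodule.mem_annihilator, smul_eq_mul,
    Ideal.mem_map_iff_of_surjective _ Ideal.Quotient.mk_surjective, forall_exists_index, and_imp,
    forall_apply_eq_imp_iff₂, ← map_mul, Ideal.Quotient.eq_zero_iff_mem]

theorem isAtom_annihilator_map_mk_iff {q C m : Ideal R} (h : IsCompl q C) (hqm : q ≤ m) :
    IsAtom (m.map (Ideal.Quotient.mk q)).annihilator ↔ IsAtom m.annihilator := by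
  have hmap (a : m.annihilator) :
      Ideal.Quotient.mk q a ∈ (m.map (Ideal.Quotient.mk q)).annihilator :=
    mk_mem_annihilator_map_iff.2 fun r hr => by
      rw [← smul_eq_mul, Submodule.mem_annihilator.1 a.2 r hr]
      exact q.zero_mem
  let f : m.annihilator →ₛₗ[Ideal.Quotient.mk q] (m.map (Ideal.Quotient.mk q)).annihilator :=
    { toFun a := ⟨Ideal.Quotient.mk q a, hmap a⟩
      map_add' _ _ := rfl
      map_smul' _ _ := rfl }
  rw [← isSimpleModule_iff_isAtom, ← isSimpleModule_iff_isAtom]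
  refine (LinearMap.isSimpleModule_iff_of_bijective f ⟨?_, ?_⟩).symm
  · refine (injective_iff_map_eq_zero f).2 fun a ha => Subtype.ext ?_
    have haq : (a : R) ∈ q := Ideal.Quotient.eq_zero_iff_mem.1 (congrArg Subtype.val ha)
    have haC : (a : R) ∈ C :=
      annihilator_le_of_codisjoint h.codisjoint (Submodule.annihilator_mono hqm a.2)
    exact h.inf_eq_bot.le ⟨haq, haC⟩
  · rintro ⟨b, hb⟩
    obtain ⟨w, rfl⟩ := Ideal.Quotient.mk_surjective b
    obtain ⟨y, hy, e, he, hye⟩ := Submodule.mem_sup.1 (h.sup_eq_top.ge (Submodule.mem_top (x := 1)))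
    have hew : e * w ∈ m.annihilator := by
      refine Submodule.mem_annihilator.2 fun r hr => h.inf_eq_bot.le ⟨?_, ?_⟩
      · rw [smul_eq_mul, mul_assoc]
        exact q.mul_mem_left e (mk_mem_annihilator_map_iff.1 hb r hr)
      · exact C.mul_mem_right r (C.mul_mem_right w he)
    refine ⟨⟨e * w, hew⟩, Subtype.ext (Ideal.Quotient.eq.2 ?_)⟩
    have hdiff : e * w - w = -(y * w) := by linear_combination w * hye
    exact hdiff ▸ q.neg_mem (q.mul_mem_right w hy)

theorem isMaximal_map_mk_of_le {q m : Ideal R} (hm : m.IsMaximal) (hqm : q ≤ m) :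
    (m.map (Ideal.Quotient.mk q)).IsMaximal :=
  Ideal.IsMaximal.map_of_surjective_of_ker_le Ideal.Quotient.mk_surjective (by rwa [Ideal.mk_ker])

theorem isLocalRing_quotient_of_isMaximal_radical {q : Ideal R} (hq : q.radical.IsMaximal) :
    IsLocalRing (R ⧸ q) := by
  refine .of_unique_max_ideal ⟨q.radical.map (Ideal.Quotient.mk q),
    isMaximal_map_mk_of_le hq Ideal.le_radical, fun M hM => ?_⟩
  have hMmax := Ideal.comap_isMaximal_of_surjective (Ideal.Quotient.mk q)
    Ideal.Quotient.mk_surjective (K := M)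
  have hqM : q ≤ M.comap (Ideal.Quotient.mk q) :=
    Ideal.mk_ker.ge.trans (Ideal.comap_mono bot_le)
  rw [hq.eq_of_le hMmax.ne_top (hMmax.isPrime.radical_le_iff.2 hqM),
    Ideal.map_comap_of_surjective _ Ideal.Quotient.mk_surjective]

theorem isGorensteinLocal_quotient_iff [IsArtinianRing R] {t : Finset (Ideal R)}
    (ht : Submodule.IsMinimalPrimaryDecomposition ⊥ t) {q : Ideal R} (hq : q ∈ t) :
    IsGorensteinLocal (R ⧸ q) ↔ IsAtom q.radical.annihilator := by
  classical
  have hcompl : IsCompl q ((t.erase q).inf id) :=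
    .of_eq (inf_inf_erase ht hq) (sup_inf_erase_eq_top ht hq)
  have hm : q.radical.IsMaximal := (Ideal.isPrime_radical (ht.primary hq)).isMaximal'
  have := isLocalRing_quotient_of_isMaximal_radical hm
  rw [isGorensteinLocal_iff_isAtom_annihilator,
    ← IsLocalRing.eq_maximalIdeal (isMaximal_map_mk_of_le hm Ideal.le_radical),
    isAtom_annihilator_map_mk_iff hcompl Ideal.le_radical]

theorem isLocallyGorenstein_iff_hasSimpleSocles [IsArtinianRing R] :
    IsLocallyGorenstein R ↔ HasSimpleSocles R := by
  constructor
  · intro h m hm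
    obtain ⟨t, ht⟩ := Submodule.IsLasker.exists_isMinimalPrimaryDecomposition
      (Submodule.isLasker R R) (⊥ : Ideal R)
    obtain ⟨q, hq, hmq⟩ := exists_mem_not_le ht
      (mt le_bot_iff.1 (annihilator_ne_bot_of_ne_top hm.ne_top))
    have hzero : m * m.annihilator ≤ q := by
      rw [Submodule.mul_annihilator]
      exact bot_le
    obtain rfl := eq_radical_of_mul_le (ht.primary hq) hm hzero hmq
    exact (isGorensteinLocal_quotient_iff ht hq).1 (h t ht q hq)
  · intro h t ht q hq
    exact (isGorensteinLocal_quotient_iff ht hq).2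
      (h _ (Ideal.isPrime_radical (ht.primary hq)).isMaximal')

end Gorenstein

section MinimalDivisor

theorem comap_mk_le_iff {R : Type*} [CommRing R] {I C : Ideal R} (hIC : I ≤ C)
    {S : Ideal (R ⧸ I)} :
    S.comap (Ideal.Quotient.mk I) ≤ C ↔ S ≤ C.map (Ideal.Quotient.mk I) := by
  rw [← Ideal.comap_le_comap_iff_of_surjective _ Ideal.Quotient.mk_surjective S,
    Ideal.comap_map_of_surjective _ Ideal.Quotient.mk_surjective, ← RingHom.ker_eq_comap_bot,
    Ideal.mk_ker, sup_eq_left.2 hIC]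

theorem comap_mk_le_self_iff {R : Type*} [CommRing R] {I : Ideal R} {S : Ideal (R ⧸ I)} :
    S.comap (Ideal.Quotient.mk I) ≤ I ↔ S = ⊥ := by
  rw [comap_mk_le_iff le_rfl, Ideal.map_quotient_self, le_bot_iff]

variable {K : Type*} [Field K] {n : ℕ} {I : Ideal (MvPolynomial (Fin n) K)}

theorem adjoin_range_coords : Algebra.adjoin K (Set.range (coords I)) = ⊤ := by
  have hrange : Set.range (coords I) = Ideal.Quotient.mkₐ K I '' Set.range MvPolynomial.X :=
    Set.range_comp (Ideal.Quotient.mkₐ K I) MvPolynomial.X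
  rw [hrange, ← AlgHom.map_adjoin, MvPolynomial.adjoin_range_X, Algebra.map_top,
    AlgHom.range_eq_top]
  exact Ideal.Quotient.mkₐ_surjective K I

variable {t : Finset (Ideal (MvPolynomial (Fin n) K))} {Q : Ideal (MvPolynomial (Fin n) K)}

theorem isMinimalDivisor_comap (ht : Submodule.IsMinimalPrimaryDecomposition I t) (hQ : Q ∈ t)
    {S : Ideal (MvPolynomial (Fin n) K ⧸ I)} (hS : IsAtom S)
    (hSQ : ¬ S.comap (Ideal.Quotient.mk I) ≤ Q) :
    IsMinimalDivisor I t Q (S.comap (Ideal.Quotient.mk I)) := by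
  classical
  set J := S.comap (Ideal.Quotient.mk I) with hJ
  have : IsSimpleModule (MvPolynomial (Fin n) K ⧸ I) S := isSimpleModule_iff_isAtom.2 hS
  have : IsSimpleModule (MvPolynomial (Fin n) K) S :=
    (isSimpleModule_iff_isSimpleModule_of_algebraMap_surjective Ideal.Quotient.mk_surjective).2 this
  set m := Module.annihilator (MvPolynomial (Fin n) K) S
  have hmmax : m.IsMaximal := IsSimpleModule.annihilator_isMaximal
  have hmJ : m * J ≤ I := by
    refine Ideal.mul_le.2 fun r hr p hp => Ideal.Quotient.eq_zero_iff_mem.1 ?_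
    exact congrArg Subtype.val (Module.mem_annihilator.1 hr ⟨_, hp⟩)
  have hIQ : I ≤ Q := ht.inf_eq ▸ Finset.inf_le hQ
  have hmQ : m = Q.radical := eq_radical_of_mul_le (ht.primary hQ) hmmax (hmJ.trans hIQ) hSQ
  have hJC : J ≤ (t.erase Q).inf id :=
    le_inf_erase_of_radical_mul_le ht hQ (hmQ ▸ hmmax) (hmQ ▸ hmJ)
  have hIJ : I ≤ J := Ideal.mk_ker.ge.trans (Ideal.comap_mono bot_le)
  refine ⟨⟨J ⊔ Q, right_lt_sup.2 hSQ, ?_⟩, ?_⟩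
  · rw [sup_inf_assoc_of_le Q hJC, inf_inf_erase ht hQ, sup_eq_left.2 hIJ]
  · rw [hJ, Ideal.map_comap_of_surjective _ Ideal.Quotient.mk_surjective, ← hmQ]
    exact finrank_eq_finrank_quotient_of_isSimpleModule K hmmax le_rfl

variable [Module.Finite K (MvPolynomial (Fin n) K ⧸ I)]

theorem exists_isMinimalDivisor (ht : Submodule.IsMinimalPrimaryDecomposition I t) (hQ : Q ∈ t) :
    ∃ J, IsMinimalDivisor I t Q J := by
  classical
  have : IsArtinianRing (MvPolynomial (Fin n) K ⧸ I) := IsArtinianRing.of_finite K _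
  set C := (t.erase Q).inf id
  have hQC : Q ⊓ C = I := inf_inf_erase ht hQ
  obtain hbot | ⟨S, hS, hSC⟩ := eq_bot_or_exists_atom_le (C.map (Ideal.Quotient.mk I))
  · rw [Ideal.map_eq_bot_iff_le_ker, Ideal.mk_ker, ← hQC, le_inf_iff] at hbot
    exact (ht.minimal hQ hbot.1).elim
  · refine ⟨_, isMinimalDivisor_comap ht hQ hS fun hSQ => hS.1 ?_⟩
    have hSQC : S.comap (Ideal.Quotient.mk I) ≤ Q ⊓ C :=
      le_inf hSQ ((comap_mk_le_iff (hQC.ge.trans inf_le_right)).2 hSC)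
    exact comap_mk_le_self_iff.1 (hSQC.trans hQC.le)

theorem IsMinimalDivisor.map_ne_bot (ht : Submodule.IsMinimalPrimaryDecomposition I t) (hQ : Q ∈ t)
    {J : Ideal (MvPolynomial (Fin n) K)} (hJ : IsMinimalDivisor I t Q J) :
    J.map (Ideal.Quotient.mk I) ≠ ⊥ := by
  intro hbot
  have hIQ : I ≤ Q.radical := (ht.inf_eq ▸ Finset.inf_le hQ : I ≤ Q).trans Ideal.le_radical
  have : Module.Finite K (MvPolynomial (Fin n) K ⧸ Q.radical) :=
    .of_surjective (Ideal.Quotient.factorₐ K hIQ).toLinearMap (Ideal.Quotient.factor_surjective hIQ)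
  have : Nontrivial (MvPolynomial (Fin n) K ⧸ Q.radical) :=
    Ideal.Quotient.nontrivial_iff.2 (Ideal.isPrime_radical (ht.primary hQ)).ne_top
  have hpos : 0 < Module.finrank K (MvPolynomial (Fin n) K ⧸ Q.radical) := Module.finrank_pos
  rw [← hJ.2, hbot] at hpos
  exact hpos.ne' (finrank_bot K (MvPolynomial (Fin n) K ⧸ I))

variable [Nontrivial (MvPolynomial (Fin n) K ⧸ I)]

theorem separatorDegree_eq_regularityIndex_iff
    (ht : Submodule.IsMinimalPrimaryDecomposition I t) (hQ : Q ∈ t) :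
    separatorDegree I t Q = regularityIndex K (coords I) ↔
      ∀ J, IsMinimalDivisor I t Q J → ¬ (J.map (Ideal.Quotient.mk I)).restrictScalars K ≤
        degreeFiltration K (coords I) (regularityIndex K (coords I) - 1) := by
  have hx := adjoin_range_coords (I := I)
  constructor
  · intro h J hJ
    have hne := hJ.map_ne_bot ht hQ
    have hle := idealRegularityIndex_le_regularityIndex hx hne
    refine (idealRegularityIndex_eq_regularityIndex_iff hx hne).1 (hle.antisymm ?_)
    rw [← h]
    refine csInf_le ⟨0, ?_⟩ ⟨J, hJ, rfl⟩
    rintro _ ⟨J', hJ', rfl⟩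
    exact idealRegularityIndex_nonneg hx (hJ'.map_ne_bot ht hQ)
  · intro h
    have hreg (J) (hJ : IsMinimalDivisor I t Q J) :=
      (idealRegularityIndex_eq_regularityIndex_iff hx (hJ.map_ne_bot ht hQ)).2 (h J hJ)
    obtain ⟨J, hJ⟩ := exists_isMinimalDivisor ht hQ
    refine IsLeast.csInf_eq ⟨⟨J, hJ, hreg J hJ⟩, ?_⟩
    rintro _ ⟨J', hJ', rfl⟩
    exact (hreg J' hJ').ge

theorem hasCayleyBacharachProperty_iff_isIdealFree :
    HasCayleyBacharachProperty I ↔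
      IsIdealFree (degreeFiltration K (coords I) (regularityIndex K (coords I) - 1)) := by
  have : IsArtinianRing (MvPolynomial (Fin n) K ⧸ I) := IsArtinianRing.of_finite K _
  constructor
  · refine fun h => isIdealFree_iff_of_isAtomic.2 fun S hS => ?_
    obtain ⟨t, ht⟩ := Submodule.IsLasker.exists_isMinimalPrimaryDecomposition
      (Submodule.isLasker _ _) I
    obtain ⟨Q, hQ, hSQ⟩ := exists_mem_not_le ht (mt comap_mk_le_self_iff.1 hS.1)
    have hsep := (separatorDegree_eq_regularityIndex_iff ht hQ).1 (h t ht Q hQ) _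
      (isMinimalDivisor_comap ht hQ hS hSQ)
    rwa [Ideal.map_comap_of_surjective _ Ideal.Quotient.mk_surjective] at hsep
  · exact fun h t ht Q hQ => (separatorDegree_eq_regularityIndex_iff ht hQ).2 fun J hJ hle =>
      hJ.map_ne_bot ht hQ (h _ hle)

end MinimalDivisor

section Equivalence

variable {k : Type*} [Field k] {A : Type*} [CommRing A] [Algebra k A] [Module.Finite k A]
  [Nontrivial A] {n : ℕ} {x : Fin n → A} (L : Type*) [Field L] [Algebra k L]

theorem hasFaithfulFormOfLeastOrder_baseChange_iff (hx : Algebra.adjoin k (Set.range x) = ⊤) :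
    HasFaithfulFormOfLeastOrder L (fun j => (1 : L) ⊗ₜ[k] x j) ↔ ∃ φ : L ⊗[k] A →ₗ[L] L,
      (degreeFiltration k x (regularityIndex k x - 1)).baseChange L ≤ LinearMap.ker φ ∧
        IsIdealFree (LinearMap.ker φ) := by
  rw [hasFaithfulFormOfLeastOrder_iff (adjoin_one_tmul_eq_top L hx), regularityIndex_baseChange,
    degreeFiltration_baseChange]

theorem hasFaithfulFormOfLeastOrder_baseChange [Infinite L]
    (hx : Algebra.adjoin k (Set.range x) = ⊤) (hsocle : HasSimpleSocles A)
    (hfree : IsIdealFree (degreeFiltration k x (regularityIndex k x - 1))) :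
    HasFaithfulFormOfLeastOrder L (fun j => (1 : L) ⊗ₜ[k] x j) := by
  obtain ⟨σ, hσ⟩ := hsocle.exists_isIdealFree_ker (k := k)
  obtain ⟨ψ, hψ⟩ := exists_ker_eq_baseChange_ker L σ
  exact (hasFaithfulFormOfLeastOrder_baseChange_iff L hx).2
    (IsIdealFree.exists_le_ker (hψ ▸ hσ.baseChange L) (hfree.baseChange L))

theorem hasSimpleSocles_and_isIdealFree_of_hasFaithfulFormOfLeastOrder_baseChange
    (hx : Algebra.adjoin k (Set.range x) = ⊤)
    (h : HasFaithfulFormOfLeastOrder L (fun j => (1 : L) ⊗ₜ[k] x j)) :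
    HasSimpleSocles A ∧ IsIdealFree (degreeFiltration k x (regularityIndex k x - 1)) := by
  obtain ⟨φ, hle, hφ⟩ := (hasFaithfulFormOfLeastOrder_baseChange_iff L hx).1 h
  exact ⟨hasSimpleSocles_of_isIdealFree_ker_baseChange hφ, (hφ.mono hle).of_baseChange⟩

end Equivalence

end CayleyBacharach

theorem theorem5p5 {K : Type u} [Field K] {n : ℕ} (I : Ideal (MvPolynomial (Fin n) K))
    (hI : ringKrullDim (MvPolynomial (Fin n) K ⧸ I) = 0) :
    ((∃ (L : Type (max u v)) (_ : Field L) (_ : Algebra K L),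
        CayleyBacharach.HasFaithfulFormOfLeastOrder L (CayleyBacharach.coordsBaseChange I L)) ↔
      (CayleyBacharach.IsLocallyGorenstein (MvPolynomial (Fin n) K ⧸ I) ∧
        CayleyBacharach.HasCayleyBacharachProperty I)) ∧
    (Infinite K →
      CayleyBacharach.IsLocallyGorenstein (MvPolynomial (Fin n) K ⧸ I) →
        CayleyBacharach.HasCayleyBacharachProperty I →
          CayleyBacharach.HasFaithfulFormOfLeastOrder K (CayleyBacharach.coordsBaseChange I K)) := by
  have : Nontrivial (MvPolynomial (Fin n) K ⧸ I) :=
    not_subsingleton_iff_nontrivial.1 fun _ =>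
      WithBot.bot_ne_zero (ringKrullDim_eq_bot_of_subsingleton.symm.trans hI)
  have : Module.Finite K (MvPolynomial (Fin n) K ⧸ I) :=
    (Module.finite_iff_krullDimLE_zero K _).2 (ringKrullDimZero_iff_ringKrullDim_eq_zero.2 hI)
  have : IsArtinianRing (MvPolynomial (Fin n) K ⧸ I) := IsArtinianRing.of_finite K _
  have hx := CayleyBacharach.adjoin_range_coords (I := I)
  rw [CayleyBacharach.isLocallyGorenstein_iff_hasSimpleSocles,
    CayleyBacharach.hasCayleyBacharachProperty_iff_isIdealFree]
  refine ⟨⟨?_, ?_⟩, fun _ => CayleyBacharach.hasFaithfulFormOfLeastOrder_baseChange K hx⟩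
  · rintro ⟨L, _, _, h⟩
    exact
      CayleyBacharach.hasSimpleSocles_and_isIdealFree_of_hasFaithfulFormOfLeastOrder_baseChange
        L hx h
  · rintro ⟨hsocle, hfree⟩
    have : Infinite (RatFunc K) := .of_injective _ (RatFunc.algebraMap_injective K)
    have : Infinite (ULift.{v} (RatFunc K)) := .of_injective ULift.up ULift.up_injective
    exact ⟨ULift.{v} (RatFunc K), inferInstance, inferInstance,
      CayleyBacharach.hasFaithfulFormOfLeastOrder_baseChange _ hx hsocle hfree⟩
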